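/- Call a join semi-lattice $(X,\le,\sqcup)$ simply a lattice. A quasi-metric on $X$ is a function $\delta_X : X\times X\to [0,\infty]\cup\{\bot\}$ such that for all $a,b,c\in X$: $a=b \Leftrightarrow \delta_X(a,b)=0$; $a\le b\Leftrightarrow \delta_X(a,b)\ne\bot$; and $a\le b\le c\Rightarrow \delta_X(a,c)\le\delta_X(a,b)+\delta_X(b,c)$. Consider $n$ processes running a deterministic protocol in an asynchronous message-passing system. In each step a single process receives at most one of the messages in transit to it, changes its local state, and sends finitely many messages to processes of its choice (possibly itself). Steps are interleaved arbitrarily. A process is correct in an infinite run if it takes infinitely many steps, and otherwise it crashes. A run is admissible for $f$ if at most $f$ processes crash and every message sent to a correct process is eventually received. Decisions are irrevocable. For $\varepsilon\ge 0$, a protocol solves the asynchronous $\varepsilon$-bounded lattice agreement problem on $(X,\delta_X)$ with at most $f$ crash faults if, for all inputs $x_1,\dots,x_n\in X$ and in every run admissible for $f$, every correct process $p_i$ eventually decides on some $y_i\in X$, and for all correct $p_i,p_j$: \begin{itemize} \item Downward-Validity: $x_i\le y_i$; \item Upward-Validity: $y_i\le\bigsqcup_{k=1}^n x_k$; \item Comparability: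 $y_i\le y_j$ or $y_j\le y_i$; \item $\varepsilon$-Tightness: if $y_i\le y_j$ then $\delta_X(y_i,y_j)\le\varepsilon$. \end{itemize} \textbf{Theorem.} Let $n\ge 2$ and $f\ge 1$, and let $X$ be a lattice with at least two elements and with a quasi-metric $\delta_X$. Then no protocol solves the asynchronous $0$-bounded lattice agreement problem on $(X,\delta_X)$ with at most $f$ crash faults. In particular, this holds for the two-element lattice $\{0<1\}$. -/

import Mathlib

open scoped ENNReal

universe u v w

/-- A quasi-metric on a join semi-lattice `X`, with values in `[0, ∞] ∪ {⊥}`. The value `⊥` marks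
the pairs that are not in the relation `≤`; by `ne_bot_iff` it does not occur in `triangle`. -/
structure LatticeQuasiMetric (X : Type u) [SemilatticeSup X] where
  dist : X → X → WithBot ℝ≥0∞
  eq_iff : ∀ a b, a = b ↔ dist a b = 0
  ne_bot_iff : ∀ a b, a ≤ b ↔ dist a b ≠ ⊥
  triangle : ∀ a b c, a ≤ b → b ≤ c → dist a c ≤ dist a b + dist b c

/-- The requirements of `ε`-bounded lattice agreement on the inputs `x` and the outputs `y`,
imposed on the outputs of the processes in `S` (the correct ones). The join in `upward` is over
the inputs of all processes. -/
structure IsBoundedLatticeAgreement {X : Type u} [SemilatticeSup X] (δ : LatticeQuasiMetric X)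
    (ε : ℝ≥0∞) {n : ℕ} (S : Set (Fin n)) (x y : Fin n → X) : Prop where
  downward : ∀ i ∈ S, x i ≤ y i
  upward : ∀ i ∈ S, y i ≤ Finset.univ.sup' ⟨i, Finset.mem_univ i⟩ x
  comparable : ∀ i ∈ S, ∀ j ∈ S, y i ≤ y j ∨ y j ≤ y i
  tight : ∀ i ∈ S, ∀ j ∈ S, y i ≤ y j → δ.dist (y i) (y j) ≤ (ε : WithBot ℝ≥0∞)

/-- A deterministic message-passing protocol for `n` processes with inputs and outputs in `X`.
In one step, process `i` in state `s` receives a message or nothing (`none`), passes to a new state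
and sends finitely many messages, each to a process of its choice (possibly itself).
`output s` is the value decided in state `s`, if any; a decision is irrevocable. -/
structure AsyncProtocol (n : ℕ) (X : Type u) where
  State : Type v
  Msg : Type w
  init : Fin n → X → State
  step : Fin n → State → Option Msg → State × List (Fin n × Msg)
  output : State → Option X
  output_stable : ∀ i s m v, output s = some v → output (step i s m).1 = some v

namespace AsyncProtocol

variable {n : ℕ} {X : Type u}

/-- A global configuration: the local states, and the messages in transit, each with its
destination. -/
structure Config (P : AsyncProtocol.{u, v, w} n X) where
  state : Fin n → P.State
  buffer : Multiset (Fin n × P.Msg)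

/-- The initial configuration for the inputs `x`: no message is in transit. -/
def initial (P : AsyncProtocol.{u, v, w} n X) (x : Fin n → X) : P.Config where
  state i := P.init i (x i)
  buffer := 0

/-- What process `i` takes out of the buffer: the message it receives, or nothing. -/
def taken (P : AsyncProtocol.{u, v, w} n X) (i : Fin n) :
    Option P.Msg → Multiset (Fin n × P.Msg)
  | none => 0
  | some m => {(i, m)}

/-- `C'` arises from `C` when process `i` takes a step in which it receives `m`. A message must be
in transit to be received; receiving nothing is always possible. -/
def Step (P : AsyncProtocol.{u, v, w} n X) (C : P.Config) (i : Fin n) (m : Option P.Msg)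
    (C' : P.Config) : Prop :=
  ∃ rest : Multiset (Fin n × P.Msg),
    C.buffer = P.taken i m + rest ∧
    C'.buffer = rest + ((P.step i (C.state i) m).2 : Multiset (Fin n × P.Msg)) ∧
    C'.state = Function.update C.state i (P.step i (C.state i) m).1

/-- An infinite asynchronous run on the inputs `x`: the processes take steps one at a time, in any
order; at time `t` the process `proc t` receives `recv t`. -/
structure Run (P : AsyncProtocol.{u, v, w} n X) (x : Fin n → X) where
  config : ℕ → P.Config
  proc : ℕ → Fin n
  recv : ℕ → Option P.Msg
  start : config 0 = P.initial x
  next : ∀ t, P.Step (config t) (proc t) (recv t) (config (t + 1))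

namespace Run

variable {P : AsyncProtocol.{u, v, w} n X} {x : Fin n → X}

/-- The correct processes of a run take infinitely many steps; the others crash, that is, take no
step from some time on. -/
def correct (R : P.Run x) : Set (Fin n) :=
  {i | ∀ t, ∃ t' ≥ t, R.proc t' = i}

/-- At most `f` processes crash, and every message to a correct process is eventually received. -/
def Admissible (R : P.Run x) (f : ℕ) : Prop :=
  (R.correct)ᶜ.ncard ≤ f ∧
  ∀ i ∈ R.correct, ∀ t m, (i, m) ∈ (R.config t).buffer →
    ∃ t' ≥ t, R.proc t' = i ∧ R.recv t' = some m

/-- Process `i` decides on `v` at some time of the run. -/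
def Decides (R : P.Run x) (i : Fin n) (v : X) : Prop :=
  ∃ t, P.output ((R.config t).state i) = some v

end Run

/-- `P` solves `ε`-bounded lattice agreement with at most `f` crash faults: for all inputs and in
all admissible runs, every correct process eventually decides, and the decisions of the correct
processes meet the requirements. -/
def SolvesBoundedLatticeAgreement [SemilatticeSup X] (P : AsyncProtocol.{u, v, w} n X)
    (δ : LatticeQuasiMetric X) (ε : ℝ≥0∞) (f : ℕ) : Prop :=
  ∀ (x : Fin n → X) (R : P.Run x), R.Admissible f →
    ∃ y : Fin n → X, (∀ i ∈ R.correct, R.Decides i (y i)) ∧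
      IsBoundedLatticeAgreement δ ε R.correct x y

end AsyncProtocol

/-!
Let `a < b`, fix two processes `p ≠ q`, and give every process the input `a`. If `p` takes no step,
then `q` still has to decide, since `p` may have crashed, and validity forces its decision to be
`a`. The other processes have heard nothing from `p`, so they can take the very same steps when the
input of `p` is `b`. If now `p` starts to run and nobody crashes, then `p` has to decide on `b`,
while the decision `a` of `q` stands. Hence the tightness `ε` is at least the distance from `a` to
`b`.

Fair executions are obtained by keeping the messages in transit in the order in which they were
sent and always delivering the oldest one.
-/

namespace LatticeQuasiMetric

variable {X : Type u} [SemilatticeSup X]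

theorem dist_pos_of_lt (δ : LatticeQuasiMetric X) {a b : X} (hab : a < b) :
    ((0 : ℝ≥0∞) : WithBot ℝ≥0∞) < δ.dist a b := by
  obtain ⟨d, hd⟩ := WithBot.ne_bot_iff_exists.1 ((δ.ne_bot_iff a b).1 hab.le)
  have hd0 : d ≠ 0 := by
    rintro rfl
    exact hab.ne ((δ.eq_iff a b).2 hd.symm)
  rw [← hd]
  exact WithBot.coe_lt_coe.2 (pos_iff_ne_zero.2 hd0)

theorem le_of_coe_lt_dist (δ : LatticeQuasiMetric X) {ε : ℝ≥0∞} {a b : X}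
    (h : (ε : WithBot ℝ≥0∞) < δ.dist a b) : a ≤ b :=
  (δ.ne_bot_iff a b).2 h.ne_bot

end LatticeQuasiMetric

theorem IsBoundedLatticeAgreement.eq_of_inputs_const {X : Type u} [SemilatticeSup X]
    {δ : LatticeQuasiMetric X} {ε : ℝ≥0∞} {n : ℕ} {S : Set (Fin n)} {a : X} {y : Fin n → X}
    (h : IsBoundedLatticeAgreement δ ε S (fun _ => a) y) {i : Fin n} (hi : i ∈ S) : y i = a :=
  le_antisymm ((h.upward i hi).trans (Finset.sup'_le _ _ fun _ _ => le_rfl)) (h.downward i hi)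

theorem exists_seq_forall_exists_ge_eq (α : Type*) [Nonempty α] [Countable α] :
    ∃ s : ℕ → α, ∀ a t, ∃ t' ≥ t, s t' = a := by
  obtain ⟨g, hg⟩ := exists_surjective_nat α
  refine ⟨fun t => g t.unpair.1, fun a t => ?_⟩
  obtain ⟨k, rfl⟩ := hg a
  exact ⟨Nat.pair k t, Nat.right_le_pair k t, by simp only [Nat.unpair_pair]⟩

namespace AsyncProtocol

variable {n : ℕ} {X : Type u} {P : AsyncProtocol.{u, v, w} n X}

section Step

variable {C C' : P.Config} {i j p : Fin n} {m : Option P.Msg}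

theorem Step.received_or_mem_buffer (h : P.Step C i m C') {a : P.Msg} (ha : (j, a) ∈ C.buffer) :
    (i = j ∧ m = some a) ∨ (j, a) ∈ C'.buffer := by
  obtain ⟨rest, hC, hC', -⟩ := h
  rw [hC, Multiset.mem_add] at ha
  rcases ha with htaken | hrest
  · cases m with
    | none => simp [taken] at htaken
    | some b =>
      obtain ⟨rfl, rfl⟩ : j = i ∧ a = b := by simpa [taken] using htaken
      exact .inl ⟨rfl, rfl⟩
  · exact .inr (hC' ▸ Multiset.mem_add.2 (.inl hrest))

theorem Step.output_eq_some (h : P.Step C i m C') {v : X}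
    (hj : P.output (C.state j) = some v) : P.output (C'.state j) = some v := by
  obtain ⟨-, -, -, hstate⟩ := h
  rw [hstate]
  rcases eq_or_ne j i with rfl | hji
  · rw [Function.update_self]
    exact P.output_stable _ _ _ _ hj
  · rwa [Function.update_of_ne hji]

/-- The configuration `C` with the local state of `p` replaced by `s`. It serves to change the
input of a process that has not taken a step yet. -/
def Config.withState (C : P.Config) (p : Fin n) (s : P.State) : P.Config where
  state := Function.update C.state p s
  buffer := C.buffer

theorem Config.withState_state_of_ne (C : P.Config) (hip : i ≠ p) (s : P.State) :
    (C.withState p s).state i = C.state i :=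
  Function.update_of_ne hip _ _

theorem Step.withState (h : P.Step C i m C') (hip : i ≠ p) (s : P.State) :
    P.Step (C.withState p s) i m (C'.withState p s) := by
  obtain ⟨rest, hC, hC', hstate⟩ := h
  rw [← C.withState_state_of_ne hip s] at hC' hstate
  refine ⟨rest, hC, hC', ?_⟩
  simp only [Config.withState, hstate]
  exact Function.update_comm hip _ _ _

theorem initial_withState_init (x : Fin n → X) (p : Fin n) (b : X) :
    (P.initial x).withState p (P.init p b) = P.initial (Function.update x p b) := by
  simp only [Config.withState, initial, Config.mk.injEq, and_true]
  funext i
  exact (Function.apply_update P.init x p b i).symm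

/-- `C'` can be reached from `C` in finitely many steps. -/
def Reachable : P.Config → P.Config → Prop :=
  Relation.ReflTransGen fun C C' => ∃ i m, P.Step C i m C'

end Step

/-- An infinite execution starting at an arbitrary configuration `C`. The runs on the inputs `x`
are the executions that start at `P.initial x`. -/
structure Execution (P : AsyncProtocol.{u, v, w} n X) (C : P.Config) where
  config : ℕ → P.Config
  proc : ℕ → Fin n
  recv : ℕ → Option P.Msg
  start : config 0 = C
  next : ∀ t, P.Step (config t) (proc t) (recv t) (config (t + 1))

/-- Fairness towards the processes in `S`: they take infinitely many steps and receive every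
message sent to them. Nothing is said about the other processes. -/
structure Execution.FairFor {C : P.Config} (E : P.Execution C) (S : Set (Fin n)) : Prop where
  exists_step : ∀ i ∈ S, ∀ t, ∃ t' ≥ t, E.proc t' = i
  exists_receipt : ∀ i ∈ S, ∀ t m, (i, m) ∈ (E.config t).buffer →
    ∃ t' ≥ t, E.proc t' = i ∧ E.recv t' = some m

/-- A configuration in which the messages in transit are listed in the order in which they were
sent, the oldest one first. -/
structure QueueConfig (P : AsyncProtocol.{u, v, w} n X) where
  state : Fin n → P.State
  queue : List (Fin n × P.Msg)

namespace QueueConfig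

/-- The configuration that results from forgetting the order of the messages. -/
def toConfig (Q : P.QueueConfig) : P.Config where
  state := Q.state
  buffer := Q.queue

theorem toConfig_surjective : Function.Surjective (toConfig : P.QueueConfig → P.Config) :=
  fun C => ⟨⟨C.state, C.buffer.toList⟩, by simp only [toConfig, Multiset.coe_toList]⟩

/-- The oldest message in transit to `i`, if any. -/
def oldest (Q : P.QueueConfig) (i : Fin n) : Option P.Msg :=
  (Q.queue.find? fun a => a.1 = i).map Prod.snd

/-- The configuration after a step of process `i` in which it receives the oldest message in
transit to it, if any. -/
def advance (Q : P.QueueConfig) (i : Fin n) : P.QueueConfig where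
  state := Function.update Q.state i (P.step i (Q.state i) (Q.oldest i)).1
  queue := Q.queue.eraseP (fun a => a.1 = i) ++ (P.step i (Q.state i) (Q.oldest i)).2

theorem queue_eq_taken_add_eraseP (Q : P.QueueConfig) (i : Fin n) :
    (Q.queue : Multiset (Fin n × P.Msg)) =
      P.taken i (Q.oldest i) + (Q.queue.eraseP fun a => a.1 = i : List (Fin n × P.Msg)) := by
  unfold oldest
  cases h : Q.queue.find? fun a => a.1 = i with
  | none =>
    rw [List.eraseP_of_forall_not (List.find?_eq_none.1 h)]
    simp [taken]
  | some a =>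
    obtain ⟨ha, u, v, hqueue, hu⟩ := List.find?_eq_some_iff_append.1 h
    obtain rfl : a.1 = i := of_decide_eq_true ha
    rw [hqueue, List.eraseP_append_right _ fun b hb => by simpa using hu b hb,
      List.eraseP_cons_of_pos (by simp)]
    exact Multiset.coe_eq_coe.2 List.perm_middle

theorem step_advance (Q : P.QueueConfig) (i : Fin n) :
    P.Step Q.toConfig i (Q.oldest i) (Q.advance i).toConfig :=
  ⟨_, Q.queue_eq_taken_add_eraseP i, (Multiset.coe_add _ _).symm, rfl⟩

theorem oldest_eq_or_queue_advance_eq {Q : P.QueueConfig} {i : Fin n} {m : P.Msg}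
    {u v : List (Fin n × P.Msg)} (hQ : Q.queue = u ++ (i, m) :: v) (j : Fin n) :
    (j = i ∧ Q.oldest j = some m) ∨
      (∃ u' v', u'.length < u.length ∧ (Q.advance j).queue = u' ++ (i, m) :: v') ∨
      (j ≠ i ∧ ∃ v', (Q.advance j).queue = u ++ (i, m) :: v') := by
  by_cases hu : ∃ a ∈ u, a.1 = j
  · obtain ⟨a, ha, haj⟩ := hu
    have hlength : (u.eraseP fun a => a.1 = j).length < u.length := by
      rw [List.length_eraseP_of_mem ha (decide_eq_true haj)]
      exact Nat.sub_one_lt (List.length_pos_of_mem ha).ne'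
    refine .inr (.inl ⟨_, v ++ (P.step j (Q.state j) (Q.oldest j)).2, hlength, ?_⟩)
    rw [advance, hQ, List.eraseP_append_left (p := fun b => b.1 = j) (decide_eq_true haj) _ ha,
      List.append_assoc, List.cons_append]
  · push Not at hu
    rcases eq_or_ne j i with rfl | hji
    · have hfind : u.find? (fun a => a.1 = j) = none := by simpa using hu
      exact .inl ⟨rfl, by simp [oldest, hQ, hfind]⟩
    · refine .inr (.inr ⟨hji, (v.eraseP fun b => b.1 = j) ++
        (P.step j (Q.state j) (Q.oldest j)).2, ?_⟩)
      rw [advance, hQ, List.eraseP_append_right _ (by simpa using hu),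
        List.eraseP_cons_of_neg (by simpa using hji.symm), List.append_assoc, List.cons_append]

/-- The configurations that arise from `Q` when the processes take steps in the order `s`. -/
def iterate (Q : P.QueueConfig) (s : ℕ → Fin n) : ℕ → P.QueueConfig
  | 0 => Q
  | t + 1 => (iterate Q s t).advance (s t)

theorem exists_oldest_eq_of_queue_eq (Q : P.QueueConfig) {s : ℕ → Fin n} {i : Fin n}
    (hs : ∀ t, ∃ t' ≥ t, s t' = i) {m : P.Msg} (t d : ℕ) (u v : List (Fin n × P.Msg))
    (hd : s (t + d) = i) (hQ : (Q.iterate s t).queue = u ++ (i, m) :: v) :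
    ∃ t' ≥ t, s t' = i ∧ (Q.iterate s t').oldest i = some m := by
  rcases oldest_eq_or_queue_advance_eq hQ (s t) with
    ⟨hst, holdest⟩ | ⟨u', v', hlt, hQ'⟩ | ⟨hst, v', hQ'⟩
  · exact ⟨t, le_rfl, hst, hst ▸ holdest⟩
  · obtain ⟨t₁, ht₁, hst₁⟩ := hs (t + 1)
    obtain ⟨t', ht', h⟩ := exists_oldest_eq_of_queue_eq Q hs (t + 1) (t₁ - (t + 1)) u' v'
      (by rwa [Nat.add_sub_cancel' ht₁]) hQ'
    exact ⟨t', Nat.le_of_succ_le ht', h⟩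
  · cases d with
    | zero => exact absurd hd hst
    | succ d =>
      obtain ⟨t', ht', h⟩ := exists_oldest_eq_of_queue_eq Q hs (t + 1) d u v'
        (by rwa [Nat.add_right_comm]) hQ'
      exact ⟨t', Nat.le_of_succ_le ht', h⟩
-- A step either delivers one of the older messages `u` or brings the next step of `i` closer.
termination_by (u.length, d)
decreasing_by
  · exact .left _ _ hlt
  · exact .right _ (by omega)

/-- The execution from `Q` in which the processes take steps in the order `s` and always receive
the oldest message in transit to them. -/
def execution (Q : P.QueueConfig) (s : ℕ → Fin n) : P.Execution Q.toConfig where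
  config t := (Q.iterate s t).toConfig
  proc := s
  recv t := (Q.iterate s t).oldest (s t)
  start := rfl
  next t := (Q.iterate s t).step_advance (s t)

theorem fairFor_execution (Q : P.QueueConfig) {s : ℕ → Fin n} {S : Set (Fin n)}
    (hs : ∀ i ∈ S, ∀ t, ∃ t' ≥ t, s t' = i) : (Q.execution s).FairFor S where
  exists_step := hs
  exists_receipt i hi t m hm := by
    obtain ⟨u, v, hQ⟩ := List.append_of_mem (Multiset.mem_coe.1 hm)
    obtain ⟨t₁, ht₁, hst₁⟩ := hs i hi t
    obtain ⟨t', ht', hst', holdest⟩ := Q.exists_oldest_eq_of_queue_eq (hs i hi) t (t₁ - t) u v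
      (by rwa [Nat.add_sub_cancel' ht₁]) hQ
    exact ⟨t', ht', hst', by rwa [← hst'] at holdest⟩

end QueueConfig

theorem exists_execution_fairFor (C : P.Config) {S : Set (Fin n)} (hS : S.Nonempty) :
    ∃ E : P.Execution C, (∀ t, E.proc t ∈ S) ∧ E.FairFor S := by
  have : Nonempty S := hS.to_subtype
  obtain ⟨Q, rfl⟩ := QueueConfig.toConfig_surjective C
  obtain ⟨s, hs⟩ := exists_seq_forall_exists_ge_eq S
  refine ⟨Q.execution fun t => s t, fun t => (s t).2, Q.fairFor_execution fun i hi t => ?_⟩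
  obtain ⟨t', ht', hst'⟩ := hs ⟨i, hi⟩ t
  exact ⟨t', ht', congrArg Subtype.val hst'⟩

namespace Execution

variable {C C' : P.Config} {i : Fin n} {m : Option P.Msg}

/-- The execution that begins with the given step from `C` to `C'` and continues with `E`. -/
def cons (h : P.Step C i m C') (E : P.Execution C') : P.Execution C where
  config t := Nat.casesOn t C E.config
  proc t := Nat.casesOn t i E.proc
  recv t := Nat.casesOn t m E.recv
  start := rfl
  next
    | 0 => by
      change P.Step C i m (E.config 0)
      rwa [E.start]
    | t + 1 => E.next t

theorem FairFor.cons {E : P.Execution C'} {S : Set (Fin n)} (hE : E.FairFor S)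
    (h : P.Step C i m C') : (E.cons h).FairFor S where
  exists_step j hj t := by
    obtain ⟨t', ht', hproc⟩ := hE.exists_step j hj t
    exact ⟨t' + 1, Nat.le_succ_of_le ht', hproc⟩
  exists_receipt j hj t a ha := by
    have exists_receipt_succ (t : ℕ) (ha : (j, a) ∈ (E.config t).buffer) :
        ∃ t' ≥ t + 1, (E.cons h).proc t' = j ∧ (E.cons h).recv t' = some a := by
      obtain ⟨t', ht', hreceipt⟩ := hE.exists_receipt j hj t a ha
      exact ⟨t' + 1, Nat.succ_le_succ ht', hreceipt⟩
    cases t with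
    | succ t => exact exists_receipt_succ t ha
    | zero =>
      rcases h.received_or_mem_buffer ha with hreceipt | hmem
      · exact ⟨0, le_rfl, hreceipt⟩
      · obtain ⟨t', -, hreceipt⟩ := exists_receipt_succ 0 (E.start.symm ▸ hmem)
        exact ⟨t', Nat.zero_le t', hreceipt⟩

theorem reachable_withState (E : P.Execution C) {p : Fin n} (hp : ∀ t, E.proc t ≠ p)
    (s : P.State) (t : ℕ) : Reachable (C.withState p s) ((E.config t).withState p s) := by
  induction t with
  | zero =>
    rw [E.start]
    exact .refl
  | succ t ih => exact ih.tail ⟨_, _, (E.next t).withState (hp t) s⟩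

end Execution

theorem Reachable.exists_execution_fairFor {C C' : P.Config} (h : Reachable C C')
    {S : Set (Fin n)} (hS : S.Nonempty) :
    ∃ E : P.Execution C, E.FairFor S ∧ ∃ t, E.config t = C' := by
  induction h using Relation.ReflTransGen.head_induction_on with
  | refl =>
    obtain ⟨E, -, hE⟩ := AsyncProtocol.exists_execution_fairFor C' hS
    exact ⟨E, hE, 0, E.start⟩
  | head hstep _ ih =>
    obtain ⟨i, m, hstep⟩ := hstep
    obtain ⟨E, hE, t, ht⟩ := ih
    exact ⟨E.cons hstep, hE.cons hstep, t + 1, ht⟩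

section Run

variable {x : Fin n → X}

namespace Run

theorem output_mono (R : P.Run x) {i : Fin n} {a : X} {s t : ℕ} (hst : s ≤ t)
    (h : P.output ((R.config s).state i) = some a) :
    P.output ((R.config t).state i) = some a := by
  induction t, hst using Nat.le_induction with
  | base => exact h
  | succ t _ ih => exact (R.next t).output_eq_some ih

theorem Decides.unique {R : P.Run x} {i : Fin n} {a b : X} (ha : R.Decides i a)
    (hb : R.Decides i b) : a = b := by
  obtain ⟨s, hs⟩ := ha
  obtain ⟨t, ht⟩ := hb
  have has := R.output_mono (le_max_left s t) hs
  have hbt := R.output_mono (le_max_right s t) ht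
  exact Option.some.inj (has.symm.trans hbt)

end Run

namespace Execution

/-- An execution from the initial configuration for `x`, as a run on the inputs `x`. -/
def toRun (E : P.Execution (P.initial x)) : P.Run x where
  config := E.config
  proc := E.proc
  recv := E.recv
  start := E.start
  next := E.next

variable {E : P.Execution (P.initial x)} {S : Set (Fin n)}

theorem FairFor.correct_toRun (hE : E.FairFor S) (hproc : ∀ t, E.proc t ∈ S) :
    E.toRun.correct = S := by
  refine Set.Subset.antisymm (fun i hi => ?_) hE.exists_step
  obtain ⟨t, -, rfl⟩ := hi 0
  exact hproc t

theorem FairFor.admissible_toRun (hE : E.FairFor S) (hproc : ∀ t, E.proc t ∈ S) {f : ℕ}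
    (hf : Sᶜ.ncard ≤ f) : E.toRun.Admissible f := by
  rw [Run.Admissible, hE.correct_toRun hproc]
  exact ⟨hf, hE.exists_receipt⟩

end Execution

end Run

namespace SolvesBoundedLatticeAgreement

variable [SemilatticeSup X] {δ : LatticeQuasiMetric X} {ε : ℝ≥0∞} {f : ℕ}

theorem exists_execution_output_eq_of_inputs_const (hP : P.SolvesBoundedLatticeAgreement δ ε f)
    (hf : 1 ≤ f) {p q : Fin n} (hqp : q ≠ p) (a : X) :
    ∃ E : P.Execution (P.initial fun _ => a),
      (∀ t, E.proc t ≠ p) ∧ ∃ t, P.output ((E.config t).state q) = some a := by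
  obtain ⟨E, hproc, hE⟩ := exists_execution_fairFor (P.initial fun _ => a) (S := {p}ᶜ) ⟨q, hqp⟩
  have hcard : ({p}ᶜ : Set (Fin n))ᶜ.ncard ≤ f := by rwa [compl_compl, Set.ncard_singleton]
  obtain ⟨y, hdec, hy⟩ := hP _ E.toRun (hE.admissible_toRun hproc hcard)
  rw [hE.correct_toRun hproc] at hdec hy
  exact ⟨E, hproc, hy.eq_of_inputs_const hqp ▸ hdec q hqp⟩

theorem exists_outputs_of_reachable [Nonempty (Fin n)] (hP : P.SolvesBoundedLatticeAgreement δ ε f)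
    {x : Fin n → X} {C : P.Config} (hC : Reachable (P.initial x) C) :
    ∃ y, IsBoundedLatticeAgreement δ ε Set.univ x y ∧
      ∀ i v, P.output (C.state i) = some v → y i = v := by
  obtain ⟨E, hE, t, rfl⟩ := hC.exists_execution_fairFor Set.univ_nonempty
  have hcard : (Set.univ : Set (Fin n))ᶜ.ncard ≤ f := by simp
  obtain ⟨y, hdec, hy⟩ := hP x E.toRun (hE.admissible_toRun (fun _ => trivial) hcard)
  rw [hE.correct_toRun fun _ => trivial] at hdec hy
  exact ⟨y, hy, fun i v hv => (hdec i trivial).unique ⟨t, hv⟩⟩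

end SolvesBoundedLatticeAgreement

end AsyncProtocol

theorem mainTheorem2_general {X : Type u} [SemilatticeSup X] (δ : LatticeQuasiMetric X) {ε : ℝ≥0∞}
    {a b : X} (hε : (ε : WithBot ℝ≥0∞) < δ.dist a b) (n f : ℕ) (hn : 2 ≤ n) (hf : 1 ≤ f) :
    ¬ ∃ P : AsyncProtocol.{u, v, w} n X, P.SolvesBoundedLatticeAgreement δ ε f := by
  rintro ⟨P, hP⟩
  have hab : a ≤ b := δ.le_of_coe_lt_dist hε
  have : Nontrivial (Fin n) := Fin.nontrivial_iff_two_le.2 hn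
  obtain ⟨q, p, hqp⟩ := exists_pair_ne (Fin n)
  obtain ⟨E, hproc, t, hq⟩ := hP.exists_execution_output_eq_of_inputs_const hf hqp a
  have hreach := E.reachable_withState hproc (P.init p b) t
  rw [AsyncProtocol.initial_withState_init] at hreach
  obtain ⟨y, hy, hdec⟩ := hP.exists_outputs_of_reachable hreach
  have hyq : y q = a := hdec q a (by rwa [(E.config t).withState_state_of_ne hqp])
  have hyp : y p = b := by
    have hx : Function.update (fun _ => a) p b ≤ fun _ => b :=
      update_le_iff.2 ⟨le_rfl, fun _ _ => hab⟩
    refine le_antisymm ((hy.upward p trivial).trans (Finset.sup'_le _ _ fun i _ => hx i)) ?_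
    simpa only [Function.update_self] using hy.downward p trivial
  have htight := hy.tight q trivial p trivial
  rw [hyq, hyp] at htight
  exact hε.not_ge (htight hab)

theorem mainTheorem2 {X : Type u} [SemilatticeSup X] [Nontrivial X] (δ : LatticeQuasiMetric X)
    (n f : ℕ) (hn : 2 ≤ n) (hf : 1 ≤ f) :
    ¬ ∃ P : AsyncProtocol.{u, v, w} n X, P.SolvesBoundedLatticeAgreement δ 0 f := by
  obtain ⟨a, b, hab⟩ := exists_lt_of_directed_le X
  exact mainTheorem2_general δ (δ.dist_pos_of_lt hab) n f hn hf
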